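/- **Theorem (variational inequality).** Let $0<p<1$ and let $A,B$ be positive definite complex $n\times n$ matrices. Write $0<X<1$ to mean that $X$ and $1-X$ are both positive definite (in particular Hermitian), where $1$ is the identity matrix; real powers of positive definite matrices are defined by the functional calculus. Then $$\operatorname{Tr}\,(A^p+B^p)^{1/p}\;\le\;\operatorname{Tr}\bigl(X^{(p-1)/p}A+(1-X)^{(p-1)/p}B\bigr)$$ for every complex $n\times n$ matrix $X$ with $0<X<1$. If $A$ and $B$ commute, then the matrix $X=A^p(A^p+B^p)^{-1}$ satisfies $0<X<1$, and equality holds for this $X$. -/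

import Mathlib

open scoped MatrixOrder ComplexOrder

/-!
The inequality rests on one estimate (`re_trace_rpow_mul_rpow_le`): for all positive definite
`A`, `Y`, `X`, with no upper bound on `X`,
`Tr A ^ p Y ^ (1 - p) ≤ p Tr X ^ ((p - 1) / p) A + (1 - p) Tr X Y`.
Let `Y = (A ^ p + B ^ p) ^ (1 / p)`, so that `Y = (A ^ p + B ^ p) Y ^ (1 - p)`. Adding the estimates
for `(A, X)` and `(B, 1 - X)` gives
`Tr Y ≤ p Tr (X ^ ((p - 1) / p) A + (1 - X) ^ ((p - 1) / p) B) + (1 - p) Tr Y`, which is the claim.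

For the estimate, let `α i` and `η i` be the diagonal entries of `A` and `Y` in an orthonormal
eigenbasis of `X`. The first step is `Tr A ^ p Y ^ (1 - p) ≤ ∑ i, α i ^ p * η i ^ (1 - p)`
(`sum_rpow_mul_rpow_mul_normSq_le`), an instance of the monotonicity behind Lieb's concavity
theorem; the second is the weighted AM-GM inequality in each coordinate. As
`a ^ p * y ^ (1 - p)` is an integral over `t > 0` of multiples of `a y / (t y + a)`, the first step
reduces to the same inequality for these functions (`sum_parallelSum_mul_normSq_le`). There the
left side, multiplied by `t`, is the minimum over all matrices `Z` of
`Tr Z* A Z + t Tr (1 - Z) Y (1 - Z)*`, and choosing `Z` diagonal in the eigenbasis of `X` gives the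
right side.

For commuting `A` and `B`, all matrices involved commute, and real powers are multiplicative on
commuting positive definite matrices (`mul_rpow_of_commute`), so equality is a computation with
exponents.
-/

section

open Finset Matrix

/-! ### An integral representation of the weighted geometric mean -/

/-- The perspective `y * f (a / y)` of the integral representation of `f x = x ^ p`. -/
theorem exists_measure_perspective_rpow {p : ℝ} (hp0 : 0 < p) (hp1 : p < 1) :
    ∃ μ : MeasureTheory.Measure ℝ, ∀ a y : ℝ, 0 < a → 0 < y →
      MeasureTheory.IntegrableOn (fun t => t ^ (p - 1) * (a * y / (t * y + a))) (Set.Ioi 0) μ ∧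
      a ^ p * y ^ (1 - p) = ∫ t in Set.Ioi 0, t ^ (p - 1) * (a * y / (t * y + a)) ∂μ := by
  obtain ⟨μ, hμ⟩ := Real.exists_measure_rpow_eq_integral_rpowIntegrand₀₁ (p := p) ⟨hp0, hp1⟩
  refine ⟨μ, fun a y ha hy => ?_⟩
  have key : ∀ t ∈ Set.Ioi (0 : ℝ), y * Real.rpowIntegrand₀₁ p t (a / y) =
      t ^ (p - 1) * (a * y / (t * y + a)) := by
    intro t ht
    have ht : 0 < t := ht
    rw [Real.rpowIntegrand₀₁_eq_pow_div ⟨hp0, hp1⟩ ht.le (by positivity)]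
    field_simp
  obtain ⟨h1, h2⟩ := hμ (a / y) (by rw [Set.mem_Ici]; positivity)
  refine ⟨MeasureTheory.IntegrableOn.congr_fun (h1.const_mul y) key measurableSet_Ioi, ?_⟩
  rw [← MeasureTheory.setIntegral_congr_fun measurableSet_Ioi key,
    MeasureTheory.integral_const_mul, ← h2, Real.div_rpow ha.le hy.le,
    Real.rpow_sub hy, Real.rpow_one]
  ring

/-! ### Diagonal entries in an orthonormal basis -/

variable {n : Type*} [Fintype n] [DecidableEq n]

theorem sum_normSq_vecMul_unitary {Q : Matrix n n ℂ} (hQ : Q ∈ unitaryGroup n ℂ) (v : n → ℂ) :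
    ∑ k, Complex.normSq ((v ᵥ* Q) k) = ∑ i, Complex.normSq (v i) := by
  have e : ∀ u : n → ℂ, ((∑ k, Complex.normSq (u k) : ℝ) : ℂ) = u ⬝ᵥ star u := by
    intro u
    simp [dotProduct, Complex.mul_conj]
  have h : (v ᵥ* Q) ⬝ᵥ star (v ᵥ* Q) = v ⬝ᵥ star v := by
    rw [star_vecMul, ← dotProduct_mulVec, mulVec_mulVec, ← star_eq_conjTranspose,
      mem_unitaryGroup_iff.1 hQ, one_mulVec]
  rw [← e, ← e] at h
  exact_mod_cast h

theorem sum_normSq_mulVec_unitary {P : Matrix n n ℂ} (hP : P ∈ unitaryGroup n ℂ) (v : n → ℂ) :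
    ∑ j, Complex.normSq ((P *ᵥ v) j) = ∑ i, Complex.normSq (v i) := by
  have hT : Pᵀ ∈ unitaryGroup n ℂ :=
    transpose_mem_unitaryGroup_iff.mpr hP
  rw [← vecMul_transpose]
  exact sum_normSq_vecMul_unitary hT v

/-- The parallel sum `a * b / (a + b)` bounds from below the cost of splitting a vector into two
parts weighted by `a` and `b`. -/
theorem parallelSum_mul_normSq_le {a b : ℝ} (ha : 0 < a) (hb : 0 < b) (u w : ℂ) :
    a * b / (b + a) * Complex.normSq (u + w) ≤
      a * Complex.normSq u + b * Complex.normSq w := by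
  rw [div_mul_eq_mul_div, div_le_iff₀ (by positivity)]
  simp only [Complex.normSq_apply, Complex.add_re, Complex.add_im]
  nlinarith [sq_nonneg (a * u.re - b * w.re), sq_nonneg (a * u.im - b * w.im)]

/-- Pinching inequality for the operator parallel sum. Here `a` and `y` are the eigenvalues of two
positive definite matrices, `P` and `Q` express their eigenbases in a reference basis, and `α`, `η`
are the diagonal entries of the two matrices in the reference basis. -/
theorem sum_parallelSum_mul_normSq_le {P Q : Matrix n n ℂ} (hP : P ∈ unitaryGroup n ℂ)
    (hQ : Q ∈ unitaryGroup n ℂ) {a y : n → ℝ} (ha : ∀ j, 0 < a j) (hy : ∀ k, 0 < y k)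
    {α η : n → ℝ} (hα : ∀ i, α i = ∑ j, a j * Complex.normSq (P j i))
    (hη : ∀ i, η i = ∑ k, y k * Complex.normSq (Q i k))
    (hα0 : ∀ i, 0 < α i) (hη0 : ∀ i, 0 < η i) {t : ℝ} (ht : 0 < t) :
    ∑ j, ∑ k, a j * y k / (t * y k + a j) * Complex.normSq ((P * Q) j k) ≤
      ∑ i, α i * η i / (t * η i + α i) := by
  -- The trial vector minimises `z i ^ 2 * α i + t * (1 - z i) ^ 2 * η i` in each coordinate.
  set z : n → ℝ := fun i => t * η i / (t * η i + α i) with hz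
  -- Summing over `k` removes `Q` by unitarity, and in `h2` summing over `j` removes `P`.
  have h1 : ∑ j, ∑ k, a j * Complex.normSq (∑ i, z i * P j i * Q i k) = ∑ i, z i ^ 2 * α i := by
    have h : ∀ j, ∑ k, a j * Complex.normSq (∑ i, z i * P j i * Q i k) =
        ∑ i, z i ^ 2 * (a j * Complex.normSq (P j i)) := fun j => by
      rw [← mul_sum]
      have := sum_normSq_vecMul_unitary hQ (fun i => (z i : ℂ) * P j i)
      simp only [vecMul, dotProduct] at this
      rw [this, mul_sum]
      refine sum_congr rfl fun i _ => ?_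
      rw [Complex.normSq_mul, Complex.normSq_ofReal]
      ring
    simp_rw [h]
    rw [sum_comm]
    simp_rw [← mul_sum, hα]
  have h2 : ∑ j, ∑ k, (t * y k) * Complex.normSq (∑ i, (1 - z i : ℝ) * P j i * Q i k) =
      ∑ i, t * (1 - z i) ^ 2 * η i := by
    have h : ∀ k, ∑ j, (t * y k) * Complex.normSq (∑ i, (1 - z i : ℝ) * P j i * Q i k) =
        ∑ i, t * (1 - z i) ^ 2 * (y k * Complex.normSq (Q i k)) := fun k => by
      rw [← mul_sum]
      have := sum_normSq_mulVec_unitary hP (fun i => ((1 - z i : ℝ) : ℂ) * Q i k)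
      simp only [mulVec, dotProduct] at this
      have e : ∀ j i, ((1 - z i : ℝ) : ℂ) * P j i * Q i k = P j i * (((1 - z i : ℝ) : ℂ) * Q i k) :=
        fun j i => by ring
      simp_rw [e]
      rw [this, mul_sum]
      refine sum_congr rfl fun i _ => ?_
      rw [Complex.normSq_mul, Complex.normSq_ofReal]
      ring
    rw [sum_comm]
    simp_rw [h]
    rw [sum_comm]
    simp_rw [← mul_sum, hη]
  have h3 : ∀ i, z i ^ 2 * α i + t * (1 - z i) ^ 2 * η i = t * (α i * η i / (t * η i + α i)) := by
    intro i
    have := hα0 i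
    have := hη0 i
    have h0 : t * η i + α i ≠ 0 := by positivity
    simp only [hz]
    field_simp
    ring
  -- Each entry of `P * Q` is split into the two parts weighted by `z` and `1 - z`.
  have h4 : t * ∑ j, ∑ k, a j * y k / (t * y k + a j) * Complex.normSq ((P * Q) j k) ≤
      t * ∑ i, α i * η i / (t * η i + α i) := by
    calc _ = ∑ j, ∑ k, a j * (t * y k) / (t * y k + a j) * Complex.normSq ((P * Q) j k) := by
          simp_rw [mul_sum]
          refine sum_congr rfl fun j _ => sum_congr rfl fun k _ => ?_
          ring
      _ ≤ ∑ j, ∑ k, (a j * Complex.normSq (∑ i, z i * P j i * Q i k) +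
            (t * y k) * Complex.normSq (∑ i, (1 - z i : ℝ) * P j i * Q i k)) := by
          refine sum_le_sum fun j _ => sum_le_sum fun k _ => ?_
          have e : (P * Q) j k = ∑ i, z i * P j i * Q i k + ∑ i, (1 - z i : ℝ) * P j i * Q i k := by
            rw [← sum_add_distrib, mul_apply]
            refine sum_congr rfl fun i _ => ?_
            push_cast
            ring
          rw [e]
          exact parallelSum_mul_normSq_le (ha j) (mul_pos ht (hy k)) _ _
      _ = ∑ i, (z i ^ 2 * α i + t * (1 - z i) ^ 2 * η i) := by
          simp_rw [sum_add_distrib]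
          rw [h1, h2]
      _ = _ := by simp_rw [h3, mul_sum]
  exact le_of_mul_le_mul_left h4 ht

/-- In the setting of `sum_parallelSum_mul_normSq_le`, the left side is `Tr A ^ p Y ^ (1 - p)`: this
trace does not decrease when `A` and `Y` are replaced by their diagonal parts. -/
theorem sum_rpow_mul_rpow_mul_normSq_le {p : ℝ} (hp0 : 0 < p) (hp1 : p < 1)
    {P Q : Matrix n n ℂ} (hP : P ∈ unitaryGroup n ℂ)
    (hQ : Q ∈ unitaryGroup n ℂ) {a y : n → ℝ} (ha : ∀ j, 0 < a j) (hy : ∀ k, 0 < y k)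
    {α η : n → ℝ} (hα : ∀ i, α i = ∑ j, a j * Complex.normSq (P j i))
    (hη : ∀ i, η i = ∑ k, y k * Complex.normSq (Q i k))
    (hα0 : ∀ i, 0 < α i) (hη0 : ∀ i, 0 < η i) :
    ∑ j, ∑ k, a j ^ p * y k ^ (1 - p) * Complex.normSq ((P * Q) j k) ≤
      ∑ i, α i ^ p * η i ^ (1 - p) := by
  obtain ⟨μ, hμ⟩ := exists_measure_perspective_rpow hp0 hp1
  have hL : ∑ j, ∑ k, a j ^ p * y k ^ (1 - p) * Complex.normSq ((P * Q) j k) =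
      ∫ t in Set.Ioi 0, ∑ j, ∑ k, t ^ (p - 1) * (a j * y k / (t * y k + a j)) *
        Complex.normSq ((P * Q) j k) ∂μ := by
    rw [MeasureTheory.integral_finsetSum _ fun j _ => MeasureTheory.integrable_finsetSum _
      fun k _ => (hμ _ _ (ha j) (hy k)).1.mul_const _]
    refine sum_congr rfl fun j _ => ?_
    rw [MeasureTheory.integral_finsetSum _ fun k _ => (hμ _ _ (ha j) (hy k)).1.mul_const _]
    refine sum_congr rfl fun k _ => ?_
    rw [MeasureTheory.integral_mul_const, ← (hμ _ _ (ha j) (hy k)).2]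
  have hR : ∑ i, α i ^ p * η i ^ (1 - p) =
      ∫ t in Set.Ioi 0, ∑ i, t ^ (p - 1) * (α i * η i / (t * η i + α i)) ∂μ := by
    rw [MeasureTheory.integral_finsetSum _ fun i _ => (hμ _ _ (hα0 i) (hη0 i)).1]
    exact sum_congr rfl fun i _ => (hμ _ _ (hα0 i) (hη0 i)).2
  rw [hL, hR]
  refine MeasureTheory.setIntegral_mono_on ?_ ?_ measurableSet_Ioi fun t ht => ?_
  · exact MeasureTheory.integrable_finsetSum _ fun j _ => MeasureTheory.integrable_finsetSum _
      fun k _ => (hμ _ _ (ha j) (hy k)).1.mul_const _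
  · exact MeasureTheory.integrable_finsetSum _ fun i _ => (hμ _ _ (hα0 i) (hη0 i)).1
  · simp_rw [mul_assoc, ← mul_sum]
    exact mul_le_mul_of_nonneg_left
      (sum_parallelSum_mul_normSq_le hP hQ ha hy hα hη hα0 hη0 ht)
      (Real.rpow_nonneg (le_of_lt ht) _)

theorem sum_mul_normSq_unitary_pos {P : Matrix n n ℂ} (hP : P ∈ unitaryGroup n ℂ) {a : n → ℝ}
    (ha : ∀ j, 0 < a j) (i : n) : 0 < ∑ j, a j * Complex.normSq (P j i) := by
  have h := sum_normSq_mulVec_unitary hP (Pi.single i 1)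
  simp only [mulVec_single_one, col_apply, Pi.single_apply, apply_ite Complex.normSq,
    Complex.normSq_one, Complex.normSq_zero, sum_ite_eq', mem_univ, if_true] at h
  obtain ⟨j, -, hj⟩ := exists_ne_zero_of_sum_ne_zero (h.trans_ne one_ne_zero)
  exact sum_pos' (fun k _ => mul_nonneg (ha k).le (Complex.normSq_nonneg _))
    ⟨j, mem_univ j, mul_pos (ha j) ((Complex.normSq_nonneg _).lt_of_ne' hj)⟩

/-! ### The trace inequality -/

theorem trace_conj_diagonal_mul_conj_diagonal (U V : Matrix n n ℂ) (a b : n → ℝ) :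
    (U * diagonal (fun j => (a j : ℂ)) * star U *
      (V * diagonal (fun k => (b k : ℂ)) * star V)).trace =
      ((∑ j, ∑ k, a j * b k * Complex.normSq ((star U * V) j k) : ℝ) : ℂ) := by
  have e : (U * diagonal (fun j => (a j : ℂ)) * star U *
      (V * diagonal (fun k => (b k : ℂ)) * star V)).trace =
      (diagonal (fun j => (a j : ℂ)) * ((star U * V) * diagonal (fun k => (b k : ℂ)) *
        star (star U * V))).trace := by
    rw [star_mul, star_star, mul_assoc U, mul_assoc U, trace_mul_comm U]
    simp only [mul_assoc]
  rw [e]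
  push_cast
  simp only [trace, diag_apply, diagonal_mul]
  refine sum_congr rfl fun j _ => ?_
  rw [mul_apply, mul_sum]
  refine sum_congr rfl fun k _ => ?_
  rw [mul_diagonal, star_apply, Complex.normSq_eq_conj_mul_self, Complex.star_def]
  ring

theorem Matrix.PosDef.rpow_eq_conj_diagonal {M : Matrix n n ℂ} (hM : M.PosDef) (r : ℝ) :
    M ^ r = (hM.1.eigenvectorUnitary : Matrix n n ℂ) *
      diagonal (fun i => ((hM.1.eigenvalues i ^ r : ℝ) : ℂ)) *
        star (hM.1.eigenvectorUnitary : Matrix n n ℂ) := by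
  rw [CFC.rpow_eq_cfc_real (ha := hM.posSemidef.nonneg), hM.1.cfc_eq, IsHermitian.cfc,
    Unitary.conjStarAlgAut_apply]
  rfl

theorem Matrix.PosDef.rpow {M : Matrix n n ℂ} (hM : M.PosDef) (r : ℝ) : (M ^ r).PosDef :=
  isStrictlyPositive_iff_posDef.1 (IsStrictlyPositive.rpow M r hM.isStrictlyPositive)

/-- In particular, the trace of a product of powers of positive definite matrices is real. -/
theorem Matrix.PosDef.trace_rpow_mul_rpow_eq {M N : Matrix n n ℂ} (hM : M.PosDef) (hN : N.PosDef)
    (r s : ℝ) : (M ^ r * N ^ s).trace =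
      ((∑ j, ∑ k, hM.1.eigenvalues j ^ r * hN.1.eigenvalues k ^ s *
        Complex.normSq ((star (hM.1.eigenvectorUnitary : Matrix n n ℂ) *
          hN.1.eigenvectorUnitary) j k) : ℝ) : ℂ) := by
  rw [hM.rpow_eq_conj_diagonal, hN.rpow_eq_conj_diagonal, trace_conj_diagonal_mul_conj_diagonal]

/-- Young's inequality for `α * x ^ ((p - 1) / p)` and `x * η`, whose powers of `x` cancel in the
geometric mean. -/
theorem rpow_mul_rpow_le_weighted {p : ℝ} (hp0 : 0 < p) (hp1 : p < 1) {x α η : ℝ} (hx : 0 < x)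
    (hα : 0 < α) (hη : 0 < η) :
    α ^ p * η ^ (1 - p) ≤ p * (α * x ^ ((p - 1) / p)) + (1 - p) * (x * η) := by
  have h := Real.geom_mean_le_arith_mean2_weighted (w₁ := p) (w₂ := 1 - p)
    (p₁ := α * x ^ ((p - 1) / p)) (p₂ := x * η) hp0.le (by linarith) (by positivity)
    (by positivity) (by ring)
  refine le_trans (le_of_eq ?_) h
  rw [Real.mul_rpow hα.le (by positivity), Real.mul_rpow hx.le hη.le, ← Real.rpow_mul hx.le,
    div_mul_cancel₀ _ hp0.ne']
  have : x ^ (p - 1) * x ^ (1 - p) = 1 := by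
    rw [← Real.rpow_add hx, show p - 1 + (1 - p) = 0 by ring, Real.rpow_zero]
  linear_combination (-(α ^ p * η ^ (1 - p))) * this

/-- A matrix Young inequality with an arbitrary positive definite weight `X`. The first powers are
written with real exponent `1` so that all three traces have the shape of
`Matrix.PosDef.trace_rpow_mul_rpow_eq`. -/
theorem re_trace_rpow_mul_rpow_le {p : ℝ} (hp0 : 0 < p) (hp1 : p < 1) {A Y X : Matrix n n ℂ}
    (hA : A.PosDef) (hY : Y.PosDef) (hX : X.PosDef) :
    (A ^ p * Y ^ (1 - p)).trace.re ≤
      p * (A ^ (1 : ℝ) * X ^ ((p - 1) / p)).trace.re +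
        (1 - p) * (X ^ (1 : ℝ) * Y ^ (1 : ℝ)).trace.re := by
  rw [hA.trace_rpow_mul_rpow_eq hY, hA.trace_rpow_mul_rpow_eq hX, hX.trace_rpow_mul_rpow_eq hY,
    Complex.ofReal_re, Complex.ofReal_re, Complex.ofReal_re]
  simp only [Real.rpow_one]
  set U : unitaryGroup n ℂ := hA.1.eigenvectorUnitary
  set V : unitaryGroup n ℂ := hY.1.eigenvectorUnitary
  set W : unitaryGroup n ℂ := hX.1.eigenvectorUnitary
  have hP : star (U : Matrix n n ℂ) * W ∈ unitaryGroup n ℂ := (star U * W).2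
  have hQ : star (W : Matrix n n ℂ) * V ∈ unitaryGroup n ℂ := (star W * V).2
  -- The eigenbasis of `X` is the reference basis.
  have hPQ : star (U : Matrix n n ℂ) * V =
      (star (U : Matrix n n ℂ) * W) * (star (W : Matrix n n ℂ) * V) := by
    rw [mul_assoc, ← mul_assoc (W : Matrix n n ℂ), mem_unitaryGroup_iff.1 W.2, one_mul]
  have hα0 := sum_mul_normSq_unitary_pos hP hA.eigenvalues_pos
  have hη0 : ∀ i, 0 < ∑ k, hY.1.eigenvalues k *
      Complex.normSq ((star (W : Matrix n n ℂ) * V) i k) :=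
    sum_mul_normSq_unitary_pos (transpose_mem_unitaryGroup_iff.mpr hQ) hY.eigenvalues_pos
  rw [hPQ]
  refine (sum_rpow_mul_rpow_mul_normSq_le hp0 hp1 hP hQ hA.eigenvalues_pos hY.eigenvalues_pos
    (fun _ => rfl) (fun _ => rfl) hα0 hη0).trans ((sum_le_sum fun i _ =>
      rpow_mul_rpow_le_weighted hp0 hp1 (hX.eigenvalues_pos i) (hα0 i) (hη0 i)).trans_eq ?_)
  rw [sum_add_distrib, ← mul_sum, ← mul_sum]
  congr 2
  · rw [sum_comm]
    refine sum_congr rfl fun i _ => ?_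
    rw [sum_mul]
    exact sum_congr rfl fun j _ => by ring
  · refine sum_congr rfl fun i _ => ?_
    rw [mul_sum]
    exact sum_congr rfl fun j _ => by ring

theorem trace_rpow_inv_le {p : ℝ} (hp0 : 0 < p) (hp1 : p < 1) {A B X : Matrix n n ℂ}
    (hA : A.PosDef) (hB : B.PosDef) (hX : X.PosDef) (hX' : (1 - X).PosDef) :
    ((A ^ p + B ^ p) ^ (1 / p)).trace ≤
        (X ^ ((p - 1) / p) * A + (1 - X) ^ ((p - 1) / p) * B).trace := by
  have hW : (A ^ p + B ^ p).PosDef := (hA.rpow p).add (hB.rpow p)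
  set W := A ^ p + B ^ p with hWdef
  have hY := hW.rpow (1 / p)
  set Y := W ^ (1 / p) with hYdef
  have hYW : Y = A ^ p * Y ^ (1 - p) + B ^ p * Y ^ (1 - p) := by
    rw [← add_mul, ← hWdef, hYdef,
      CFC.rpow_rpow W (1 / p) (1 - p) (by positivity) hW.isStrictlyPositive]
    nth_rw 2 [← CFC.rpow_one W hW.posSemidef.nonneg]
    rw [← CFC.rpow_add hW.isUnit]
    congr 1
    field_simp
    ring
  have one : ∀ {M : Matrix n n ℂ}, M.PosDef → M ^ (1 : ℝ) = M :=
    fun hM => CFC.rpow_one _ hM.posSemidef.nonneg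
  -- The estimate is applied to `(A, X)` and `(B, 1 - X)`; the terms `Tr X Y` and `Tr (1 - X) Y` add
  -- up to `Tr Y`.
  have h1 := re_trace_rpow_mul_rpow_le hp0 hp1 hA hY hX
  have h2 := re_trace_rpow_mul_rpow_le hp0 hp1 hB hY hX'
  have i1 := hA.trace_rpow_mul_rpow_eq hX 1 ((p - 1) / p)
  have i2 := hB.trace_rpow_mul_rpow_eq hX' 1 ((p - 1) / p)
  rw [one hA, one hX, one hY] at h1
  rw [one hB, one hX', one hY] at h2
  rw [one hA] at i1
  rw [one hB] at i2
  have h3 : (X * Y).trace.re + ((1 - X) * Y).trace.re = Y.trace.re := by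
    rw [← Complex.add_re, ← trace_add, ← add_mul, add_sub_cancel, one_mul]
  have h4 : Y.trace.re = (A ^ p * Y ^ (1 - p)).trace.re + (B ^ p * Y ^ (1 - p)).trace.re := by
    rw [← Complex.add_re, ← trace_add, ← hYW]
  -- The order on `ℂ` also requires equal imaginary parts: both sides are real.
  rw [trace_add, trace_mul_comm _ A, trace_mul_comm _ B, Complex.le_def]
  constructor
  · rw [Complex.add_re]
    nlinarith
  · rw [Complex.add_im, i1, i2, Complex.ofReal_im, Complex.ofReal_im,
      (Complex.nonneg_iff.1 hY.posSemidef.trace_nonneg).2.symm, add_zero]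

/-! ### Powers of commuting matrices and the case of equality -/

open scoped Matrix.Norms.L2Operator in
/-- The operator norm is only opened for the lemmas on `CFC.log`; it induces the usual topology on
matrices, so the power is the one of the ambient functional calculus. -/
theorem rpow_eq_exp_smul_log {M : Matrix n n ℂ} (hM : IsStrictlyPositive M) (r : ℝ) :
    M ^ r = NormedSpace.exp (r • CFC.log M) := by
  have hpos : ∀ x ∈ spectrum ℝ M, 0 < x := fun x hx => hM.spectrum_pos hx
  have hc : ContinuousOn Real.log (spectrum ℝ M) :=
    Real.continuousOn_log.mono fun x hx => (hpos x hx).ne'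
  have hsa : IsSelfAdjoint M := hM.isSelfAdjoint
  rw [CFC.log, ← cfc_const_mul r Real.log M hc,
    ← CFC.real_exp_eq_normedSpace_exp (cfc_predicate _ _),
    ← cfc_comp' Real.exp _ M, CFC.rpow_eq_cfc_real (ha := hM.nonneg)]
  refine cfc_congr fun x hx => ?_
  rw [Real.rpow_def_of_pos (hpos x hx), mul_comm]

open scoped Matrix.Norms.L2Operator in
/-- The logarithms of commuting positive definite matrices commute, so the functional equation of
the exponential applies. -/
theorem mul_rpow_of_commute {M N : Matrix n n ℂ} (hM : IsStrictlyPositive M)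
    (hN : IsStrictlyPositive N) (hMN : Commute M N) (r : ℝ) : (M * N) ^ r = M ^ r * N ^ r := by
  have hlog : Commute (CFC.log M) (CFC.log N) :=
    ((hMN.cfc_real Real.log).symm.cfc_real Real.log).symm
  have hadd : CFC.log (M * N) = CFC.log M + CFC.log N := by
    rw [← CFC.log_exp (CFC.log M + CFC.log N) (IsSelfAdjoint.log.add IsSelfAdjoint.log),
      Matrix.exp_add_of_commute _ _ hlog, CFC.exp_log M, CFC.exp_log N]
  rw [rpow_eq_exp_smul_log ((IsStrictlyPositive.commute_iff hM hN).1 hMN),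
    rpow_eq_exp_smul_log hM, rpow_eq_exp_smul_log hN, hadd, smul_add,
    Matrix.exp_add_of_commute _ _ ((hlog.smul_left r).smul_right r)]

theorem Matrix.PosDef.inv_eq_rpow_neg_one {S : Matrix n n ℂ} (hS : S.PosDef) :
    S⁻¹ = S ^ (-1 : ℝ) := by
  rw [nonsing_inv_eq_ringInverse, CFC.inverse_eq_rpow_neg_one hS.isStrictlyPositive]

theorem commute_rpow_rpow {M N : Matrix n n ℂ} (hMN : Commute M N) (r s : ℝ) :
    Commute (M ^ r) (N ^ s) :=
  ((hMN.cfc_nnreal (· ^ r)).symm.cfc_nnreal (· ^ s)).symm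

theorem Matrix.PosDef.rpow_mul_inv_of_commute {A S : Matrix n n ℂ} (hA : A.PosDef) (hS : S.PosDef)
    (h : Commute A S) (p : ℝ) : (A ^ p * S⁻¹).PosDef := by
  rw [hS.inv_eq_rpow_neg_one]
  exact isStrictlyPositive_iff_posDef.1 ((IsStrictlyPositive.commute_iff
    (hA.rpow p).isStrictlyPositive (hS.rpow (-1)).isStrictlyPositive).1 (commute_rpow_rpow h _ _))

theorem Matrix.PosDef.rpow_mul_inv_rpow_mul_of_commute {p : ℝ} (hp0 : p ≠ 0) {A S : Matrix n n ℂ}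
    (hA : A.PosDef) (hS : S.PosDef) (h : Commute A S) :
    (A ^ p * S⁻¹) ^ ((p - 1) / p) * A = A ^ p * S ^ ((1 - p) / p) := by
  have hpow : A ^ (p - 1) * A = A ^ p := by
    nth_rw 2 [← CFC.rpow_one A hA.posSemidef.nonneg]
    rw [← CFC.rpow_add hA.isUnit, sub_add_cancel]
  have hcomm : Commute (S ^ ((1 - p) / p)) A := by
    have := commute_rpow_rpow h.symm ((1 - p) / p) 1
    rwa [CFC.rpow_one A hA.posSemidef.nonneg] at this
  rw [hS.inv_eq_rpow_neg_one, mul_rpow_of_commute (hA.rpow p).isStrictlyPositive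
      (hS.rpow (-1)).isStrictlyPositive (commute_rpow_rpow h _ _),
    CFC.rpow_rpow A _ _ hp0 hA.isStrictlyPositive,
    CFC.rpow_rpow S _ _ (by norm_num) hS.isStrictlyPositive,
    show p * ((p - 1) / p) = p - 1 by field_simp,
    show -1 * ((p - 1) / p) = (1 - p) / p by ring, mul_assoc, hcomm.eq, ← mul_assoc, hpow]

/-- For commuting `A` and `B` the equality already holds between the matrices, before taking
traces. -/
theorem rpow_inv_eq_of_commute {p : ℝ} (hp0 : 0 < p) {A B : Matrix n n ℂ}
    (hA : A.PosDef) (hB : B.PosDef) (hAB : Commute A B) :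
    (A ^ p * (A ^ p + B ^ p)⁻¹).PosDef ∧ (1 - A ^ p * (A ^ p + B ^ p)⁻¹).PosDef ∧
      (A ^ p + B ^ p) ^ (1 / p) =
        (A ^ p * (A ^ p + B ^ p)⁻¹) ^ ((p - 1) / p) * A +
          (1 - A ^ p * (A ^ p + B ^ p)⁻¹) ^ ((p - 1) / p) * B := by
  have hS : (A ^ p + B ^ p).PosDef := (hA.rpow p).add (hB.rpow p)
  have hcomm : ∀ {M N : Matrix n n ℂ}, N.PosDef → Commute M N → Commute N (M ^ p) :=
    fun hN h => by
      have := commute_rpow_rpow h.symm 1 p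
      rwa [CFC.rpow_one _ hN.posSemidef.nonneg] at this
  have hAS : Commute A (A ^ p + B ^ p) :=
    (hcomm hA (Commute.refl A)).add_right (hcomm hA hAB.symm)
  have hBS : Commute B (A ^ p + B ^ p) :=
    (hcomm hB hAB).add_right (hcomm hB (Commute.refl B))
  have hX' : 1 - A ^ p * (A ^ p + B ^ p)⁻¹ = B ^ p * (A ^ p + B ^ p)⁻¹ := by
    rw [sub_eq_iff_eq_add', ← add_mul,
      mul_nonsing_inv _ ((isUnit_iff_isUnit_det _).1 hS.isUnit)]
  rw [hX']
  refine ⟨hA.rpow_mul_inv_of_commute hS hAS p, hB.rpow_mul_inv_of_commute hS hBS p, ?_⟩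
  rw [hA.rpow_mul_inv_rpow_mul_of_commute hp0.ne' hS hAS,
    hB.rpow_mul_inv_rpow_mul_of_commute hp0.ne' hS hBS, ← add_mul]
  nth_rw 2 [← CFC.rpow_one (A ^ p + B ^ p) hS.posSemidef.nonneg]
  rw [← CFC.rpow_add hS.isUnit]
  congr 1
  field_simp
  ring

end

theorem mainTheorem7 (n : ℕ) (p : ℝ) (hp0 : 0 < p) (hp1 : p < 1)
    (A B : Matrix (Fin n) (Fin n) ℂ) (hA : A.PosDef) (hB : B.PosDef) :
    (∀ X : Matrix (Fin n) (Fin n) ℂ, X.PosDef → (1 - X).PosDef →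
      ((A ^ p + B ^ p) ^ (1 / p)).trace ≤
        (X ^ ((p - 1) / p) * A + (1 - X) ^ ((p - 1) / p) * B).trace) ∧
    (Commute A B → ∀ X : Matrix (Fin n) (Fin n) ℂ, X = A ^ p * (A ^ p + B ^ p)⁻¹ →
      X.PosDef ∧ (1 - X).PosDef ∧
      ((A ^ p + B ^ p) ^ (1 / p)).trace =
        (X ^ ((p - 1) / p) * A + (1 - X) ^ ((p - 1) / p) * B).trace) := by
  refine ⟨fun X hX hX' => trace_rpow_inv_le hp0 hp1 hA hB hX hX', ?_⟩
  rintro hAB X rfl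
  obtain ⟨h1, h2, h3⟩ := rpow_inv_eq_of_commute hp0 hA hB hAB
  exact ⟨h1, h2, congrArg Matrix.trace h3⟩
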